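/- Let $N\ge 2$ be an integer with prime factorization $N=\prod_{k=1}^m p_k^{r_k}$ ($p_1,\dots,p_m$ distinct primes, $r_k\ge 1$). For $S\subseteq\{1,\dots,m\}$ put $P_S=\prod_{k\in S}p_k$ (so $P_\emptyset=1$), let $P_N=\prod_{k=1}^m(p_k-1)$, and let $\mu_N=2$ if $m=1$ and $p_1\equiv 1\pmod 8$, and $\mu_N=1$ otherwise. Let $\eta(\tau)=q^{1/24}\prod_{n=1}^\infty(1-q^n)$, where $q=e^{2\pi i\tau}$ and $q^{1/24}=e^{2\pi i\tau/24}$, be the Dedekind eta-function on the complex upper half-plane $\mathbb{H}$. Then the $\eta$-quotient $$g(\tau)=\prod_{S\subseteq\{1,\dots,m\}}\eta\bigl((N/P_S)\tau\bigr)^{24(-1)^{|S|}\mu_N/\gcd(24,P_N)}\qquad(\tau\in\mathbb{H})$$ is a weakly holomorphic modular function on $\Gamma_0(N)=\left\{\begin{pmatrix}a&b\\c&d\end{pmatrix}\in\mathrm{SL}_2(\mathbb{Z}) : c\equiv 0\pmod N\right\}$ with rational Fourier coefficients. That is, $g$ is holomorphic on $\mathbb{H}$; $g(\gamma\tau)=g(\tau)$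 for all $\gamma\in\Gamma_0(N)$ and $\tau\in\mathbb{H}$; $g$ is meromorphic at all cusps, i.e. for every $\gamma\in\mathrm{SL}_2(\mathbb{Z})$ there are an integer $h\ge1$ and complex numbers $c_n$ $(n\in\mathbb{Z})$, zero for all sufficiently negative $n$, such that $g(\gamma\tau)=\sum_{n\in\mathbb{Z}} c_n e^{2\pi i n\tau/h}$ for all $\tau\in\mathbb{H}$; and the expansion of $g$ itself has the form $g(\tau)=\sum_{n\in\mathbb{Z}}a_nq^n$ with all $a_n\in\mathbb{Q}$ and $a_n=0$ for all sufficiently negative $n$. -/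

import Mathlib

open scoped MatrixGroups Manifold

noncomputable section

namespace EtaQuotient

/-- `P_S`, the product of the elements of `S` (equal to `1` if `S` is empty). -/
def primeProd (S : Finset ℕ) : ℕ := ∏ p ∈ S, p

/-- `P_N = ∏ (p - 1)`, the product being over the prime divisors `p` of `N`. -/
def totProd (N : ℕ) : ℕ := ∏ p ∈ N.primeFactors, (p - 1)

/-- `μ_N`: it is `2` if `N` has exactly one prime divisor and this prime is `1` modulo `8`,
and it is `1` otherwise. -/
def mu (N : ℕ) : ℕ :=
  if N.primeFactors.card = 1 ∧ ∀ p ∈ N.primeFactors, p ≡ 1 [MOD 8] then 2 else 1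

/-- The exponent `24 (-1)^{|S|} μ_N / gcd(24, P_N)`. The division of integers is exact, because
`gcd(24, P_N)` divides `24`. -/
def exponent (N : ℕ) (S : Finset ℕ) : ℤ :=
  24 * (-1) ^ S.card * (mu N : ℤ) / (Nat.gcd 24 (totProd N) : ℤ)

/-- The eta-quotient `g(τ) = ∏_S η((N / P_S) τ) ^ (24 (-1)^{|S|} μ_N / gcd(24, P_N))`, where `S`
runs over all sets of prime divisors of `N`. The division `N / P_S` is exact. -/
def g (N : ℕ) (τ : UpperHalfPlane) : ℂ :=
  ∏ S ∈ N.primeFactors.powerset,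
    ModularForm.eta (((N / primeProd S : ℕ) : ℂ) * (τ : ℂ)) ^ exponent N S

/-- `f(τ) = ∑ c_n q^{n/h}` for all `τ` in the upper half-plane, with `q^{1/h} = exp(2πiτ/h)`,
where the `c_n` are the coefficients of the Laurent series `c`, so that `c_n = 0` for all
sufficiently negative `n`. -/
def HasFourierExpansion (h : ℕ) (f : UpperHalfPlane → ℂ) (c : LaurentSeries ℂ) : Prop :=
  ∀ τ : UpperHalfPlane,
    HasSum (fun n : ℤ ↦ c.coeff n * Function.Periodic.qParam (h : ℝ) (τ : ℂ) ^ n) (f τ)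

/-- A weakly holomorphic modular function on `Γ`: holomorphic on the upper half-plane,
`Γ`-invariant, and meromorphic at every cusp, i.e. for every `γ` in `SL₂(ℤ)` the function
`f ∘ γ` has a Fourier expansion in some `q^{1/h}` with finite principal part. -/
structure IsWeaklyHolomorphicModularFunction (Γ : Subgroup SL(2, ℤ))
    (f : UpperHalfPlane → ℂ) : Prop where
  holomorphic : MDifferentiable 𝓘(ℂ) 𝓘(ℂ) f
  invariant : ∀ γ ∈ Γ, ∀ τ : UpperHalfPlane, f (γ • τ) = f τ
  meromorphic_at_cusps : ∀ γ : SL(2, ℤ), ∃ h : ℕ, 0 < h ∧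
    ∃ c : LaurentSeries ℂ, HasFourierExpansion h (fun τ ↦ f (γ • τ)) c

/-- The Fourier coefficients of `f` with respect to `q = exp(2πiτ)` exist and are rational. -/
def HasRationalFourierCoefficients (f : UpperHalfPlane → ℂ) : Prop :=
  ∃ c : LaurentSeries ℂ, HasFourierExpansion 1 f c ∧ ∀ n : ℤ, ∃ r : ℚ, c.coeff n = (r : ℂ)

end EtaQuotient

end

/-!
Gordon, Hughes and Newman: `∏ η(δ τ) ^ r_δ` over `δ ∣ N` is a modular function on `Γ₀(N)` if
`∑ r_δ = 0`, `24 ∣ ∑ r_δ δ`, `24 ∣ ∑ r_δ N / δ` and `∏ δ ^ r_δ` is a square. The idea is that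
`η(γτ) = χ(γ) √(cτ + d) η(τ)`, where for odd `d > 0` the multiplier `χ(γ)` is the Jacobi symbol
`(c / d)` times an explicit 24th root of unity; the multiplier is checked along the generators of
`SL₂(ℤ)`. In the eta quotient the square roots, the Jacobi symbols and the roots of unity cancel.
At a cusp one compares `η(δ γτ) ^ 24` with the discriminant at a point whose imaginary part is a
multiple of that of `τ`, so that the quotient has at most a pole there, and at infinity the
coefficients are rational because the Euler product has integral coefficients in `q`.

For `g`, the two divisibility conditions come from `∑_S (-1)^|S| P_S = ± P_N`. The square condition
is clear for even exponents. The exponents are odd only if `N` has `m ≥ 2` prime divisors, and then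
a prime `p` of multiplicity `r` in `N` has even multiplicity `2 ^ m r - 2 ^ (m - 1)` in
`∏_S N / P_S`.
-/

namespace EtaQuotient

open Complex hiding eta
open ModularForm
open UpperHalfPlane hiding I
open MatrixGroups ModularGroup CongruenceSubgroup Matrix.SpecialLinearGroup
open Asymptotics Filter
open scoped NumberTheorySymbols Real Topology

/-! ### Square roots and the values of the eta function at generators -/

lemma sqrt_mul {z w : ℂ} (hz : z ∈ slitPlane) (hw : 0 < w.im) (hzw : 0 < z.im → 0 < (z * w).im) :
    Complex.sqrt (z * w) = Complex.sqrt z * Complex.sqrt w := by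
  have hz0 := slitPlane_ne_zero hz
  have hw0 : w ≠ 0 := slitPlane_ne_zero (.inr hw.ne')
  have hargw : 0 < arg w :=
    (arg_nonneg_iff.2 hw.le).lt_of_ne' fun h ↦ hw.ne' (arg_eq_zero_iff.1 h).2
  suffices harg : arg z + arg w ≤ π by
    rw [sqrt_eq_exp hz0, sqrt_eq_exp hw0, sqrt_eq_exp (mul_ne_zero hz0 hw0),
      (log_mul_eq_add_log_iff hz0 hw0).2 ⟨by linarith [neg_pi_lt_arg z], harg⟩, add_div,
      Complex.exp_add]
  rcases le_or_gt (arg z) 0 with hargz | hargz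
  · linarith [arg_le_pi w]
  · have hzim : 0 < z.im := (arg_nonneg_iff.1 hargz.le).lt_of_ne' fun h ↦
      hargz.ne' (arg_eq_zero_iff.2 ⟨((mem_slitPlane_iff.1 hz).resolve_right (· h)).le, h⟩)
    have him : (z * w).im = ‖z‖ * ‖w‖ * Real.sin (arg z + arg w) := by
      rw [Real.sin_add, mul_im, ← norm_mul_cos_arg z, ← norm_mul_sin_arg z, ← norm_mul_cos_arg w,
        ← norm_mul_sin_arg w]
      ring
    by_contra! hlt
    have hsin : Real.sin (arg z + arg w) ≤ 0 := by
      rw [← neg_nonneg, ← Real.sin_sub_pi]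
      exact Real.sin_nonneg_of_nonneg_of_le_pi (by linarith)
        (by linarith [arg_le_pi z, arg_le_pi w])
    exact (him ▸ hzw hzim).not_ge (mul_nonpos_of_nonneg_of_nonpos (by positivity) hsin)

/-- The primitive root of unity `exp (2πi / 24)`. -/
noncomputable def zeta24 : ℂ := cexp (2 * π * I / 24)

lemma zeta24_ne_zero : zeta24 ≠ 0 := exp_ne_zero _

lemma zeta24_zpow_twelve_mul (k : ℤ) : zeta24 ^ (12 * k) = (-1) ^ k := by
  rw [zpow_mul, ← Complex.exp_pi_mul_I, zeta24, ← Complex.exp_int_mul]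
  congr 2
  push_cast
  ring

lemma zeta24_zpow_eq_one {k : ℤ} (hk : 24 ∣ k) : zeta24 ^ k = 1 := by
  obtain ⟨m, rfl⟩ := hk
  rw [show 24 * m = 12 * (2 * m) by ring, zeta24_zpow_twelve_mul, (even_two_mul m).neg_one_zpow]

lemma zeta24_zpow_congr {k l : ℤ} (h : 24 ∣ k - l) : zeta24 ^ k = zeta24 ^ l := by
  rw [← sub_add_cancel k l, zpow_add₀ zeta24_ne_zero, zeta24_zpow_eq_one h, one_mul]

lemma sqrt_I_eq_zeta24_pow : Complex.sqrt I = zeta24 ^ 3 := by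
  rw [sqrt_eq_exp I_ne_zero, log_I, zeta24, ← Complex.exp_nat_mul]
  congr 1
  push_cast
  ring

lemma eta_add_one (τ : ℂ) : eta (τ + 1) = zeta24 * eta τ := by
  have hq24 : Function.Periodic.qParam 24 (τ + 1) = zeta24 * Function.Periodic.qParam 24 τ := by
    simp only [Function.Periodic.qParam, zeta24, ← Complex.exp_add]
    congr 1
    push_cast
    ring
  have hq (n : ℕ) : eta_q n (τ + 1) = eta_q n τ := by
    have : Function.Periodic.qParam 1 (τ + 1) = Function.Periodic.qParam 1 τ := by
      simp only [Function.Periodic.qParam, ofReal_one, div_one, mul_add, mul_one]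
      exact exp_periodic _
    simp only [eta_q, this]
  simp only [eta, hq24, hq, mul_assoc]

lemma eta_add_int (τ : ℂ) (n : ℤ) : eta (τ + n) = zeta24 ^ n * eta τ := by
  induction n using Int.induction_on with
  | zero => simp
  | succ n ih =>
    rw [Int.cast_add, Int.cast_one, ← add_assoc, eta_add_one, ih, zpow_add_one₀ zeta24_ne_zero]
    ring
  | pred n ih =>
    rw [← mul_right_inj' zeta24_ne_zero, ← eta_add_one, zpow_sub_one₀ zeta24_ne_zero, ← mul_assoc,
      mul_left_comm, mul_inv_cancel₀ zeta24_ne_zero, mul_one, ← ih]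
    push_cast
    ring_nf

lemma eta_div_add_one (τ : ℍ) :
    eta (τ / (τ + 1)) = zeta24⁻¹ * Complex.sqrt (τ + 1) * eta τ := by
  have him : 0 < ((τ : ℂ) + 1).im := by simpa using τ.im_pos
  have hne : (τ : ℂ) + 1 ≠ 0 := slitPlane_ne_zero (.inr him.ne')
  have hS : eta (-1 / (τ + 1)) = (zeta24 ^ 3)⁻¹ * (Complex.sqrt (τ + 1) * eta (τ + 1)) := by
    simpa [sqrt_I_eq_zeta24_pow] using eta_comp_eq_csqrt_I_inv him
  rw [show (τ / (τ + 1) : ℂ) = -1 / (τ + 1) + 1 by field_simp; ring, eta_add_one, hS, eta_add_one]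
  field_simp [zeta24_ne_zero]

/-! ### Quadratic reciprocity and the multiplier of the eta function -/

lemma jacobiSym_eq_of_emod_four_eq_one {v : ℤ} (hv : v % 4 = 1) {b : ℕ} (hb : Odd b) :
    J(v | b) = J(b | v.natAbs) := by
  obtain ⟨n, rfl | rfl⟩ := v.eq_nat_or_neg
  · exact jacobiSym.quadratic_reciprocity_one_mod_four (by omega) hb
  · have hn3 : n % 4 = 3 := by omega
    rw [jacobiSym.neg _ hb, Int.natAbs_neg, Int.natAbs_natCast]
    rcases Nat.odd_mod_four_iff.1 (Nat.odd_iff.1 hb) with hb4 | hb4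
    · rw [jacobiSym.quadratic_reciprocity_one_mod_four' (Nat.odd_iff.2 (by omega)) hb4,
        ZMod.χ₄_nat_one_mod_four hb4, one_mul]
    · rw [jacobiSym.quadratic_reciprocity_three_mod_four hn3 hb4,
        ZMod.χ₄_nat_three_mod_four hb4, neg_one_mul, neg_neg]

lemma jacobiSym_add_of_four_dvd {c : ℤ} (hc : 4 ∣ c) {d d' : ℕ} (hd : Odd d)
    (hd' : (d' : ℤ) = d + c) : J(c | d') = J(c | d) := by
  have hd2 := Nat.odd_iff.1 hd
  have hd'2 : d' % 2 = 1 := by omega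
  rw [← jacobiSym.div_four_left (by omega) hd2, ← jacobiSym.div_four_left (by omega) hd'2,
    jacobiSym.mod_right _ hd, jacobiSym.mod_right _ (Nat.odd_iff.2 hd'2)]
  congr 1
  rw [show 4 * (c / 4).natAbs = c.natAbs by omega]
  zify
  rw [hd', Int.emod_abs, Int.emod_abs, Int.add_emod_right]

lemma jacobiSym_two_mul_add {u : ℤ} (hu : Odd u) {d d' : ℕ} (hd : Odd d)
    (hd' : (d' : ℤ) = d + 2 * u) : J(2 * u | d') = -ZMod.χ₄ d * J(2 * u | d) := by
  have hd'odd : Odd d' := by have := Nat.odd_iff.1 hd; exact Nat.odd_iff.2 (by omega)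
  have hrec (v : ℤ) (hv : v.natAbs = u.natAbs) (hv4 : v % 4 = 1) : J(v | d') = J(v | d) := by
    rw [jacobiSym_eq_of_emod_four_eq_one hv4 hd, jacobiSym_eq_of_emod_four_eq_one hv4 hd'odd, hv]
    refine jacobiSym.mod_left' ?_
    rw [hd', Int.natCast_natAbs, Int.emod_abs, Int.emod_abs, Int.add_mul_emod_self_right]
  rw [jacobiSym.mul_left, jacobiSym.mul_left, jacobiSym.at_two hd, jacobiSym.at_two hd'odd]
  have hd2 := Nat.odd_iff.1 hd
  have hu2 := Int.odd_iff.1 hu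
  rcases (by omega : u % 4 = 1 ∨ -u % 4 = 1) with hu4 | hu4
  · have hχ : ZMod.χ₈ d' = -(ZMod.χ₄ d * ZMod.χ₈ d) := by
      simp only [ZMod.χ₈_nat_eq_if_mod_eight, ZMod.χ₄_nat_eq_if_mod_four]
      split_ifs <;> omega
    rw [hrec u rfl hu4, hχ]
    ring
  · have hχ : ZMod.χ₈ d' * ZMod.χ₄ d' = -ZMod.χ₈ d := by
      simp only [ZMod.χ₈_nat_eq_if_mod_eight, ZMod.χ₄_nat_eq_if_mod_four]
      split_ifs <;> omega
    have hχ₄ : ZMod.χ₄ d * ZMod.χ₄ d = 1 := by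
      simp only [ZMod.χ₄_nat_eq_if_mod_four]
      split_ifs <;> omega
    rw [← neg_neg u, jacobiSym.neg _ hd, jacobiSym.neg _ hd'odd, hrec (-u) u.natAbs_neg hu4]
    linear_combination J(-u | d) * hχ + ZMod.χ₈ d * J(-u | d) * hχ₄

lemma jacobiSym_add_eq_negOnePow_mul {u v : ℤ} {d d' : ℕ} (hd : (d : ℤ) + 1 = 2 * v)
    (hd' : (d' : ℤ) = d + 2 * u) : J(2 * u | d') = (u * v).negOnePow * J(2 * u | d) := by
  have hdodd : Odd d := Nat.odd_iff.2 (by omega)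
  rcases Int.even_or_odd u with hu | hu
  · obtain ⟨k, rfl⟩ := hu
    rw [jacobiSym_add_of_four_dvd ⟨k, by ring⟩ hdodd hd',
      Int.negOnePow_even _ (.mul_right ⟨k, rfl⟩ v), Units.val_one, one_mul]
  · rw [jacobiSym_two_mul_add hu hdodd hd']
    congr 1
    rcases Int.even_or_odd v with hv | hv
    · have hd4 : d % 4 = 3 := by have := Int.even_iff.1 hv; omega
      rw [ZMod.χ₄_nat_three_mod_four hd4, Int.negOnePow_even _ (hv.mul_left u), neg_neg,
        Units.val_one]
    · have hd4 : d % 4 = 1 := by have := Int.odd_iff.1 hv; omega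
      rw [ZMod.χ₄_nat_one_mod_four hd4, Int.negOnePow_odd _ (hu.mul hv), Units.val_neg,
        Units.val_one]

lemma three_dvd_mul_one_sub_sq (n : ℤ) : 3 ∣ n * (1 - n ^ 2) := by
  obtain h | h | h : n % 3 = 0 ∨ n % 3 = 1 ∨ n % 3 = 2 := by omega
  all_goals simp [Int.dvd_iff_emod_eq_zero, Int.mul_emod, Int.sub_emod, pow_two, h]

lemma twentyFour_dvd_mul_one_sub_sq {d : ℤ} (hd : Odd d) : 24 ∣ d * (1 - d ^ 2) := by
  have h8 : 8 ∣ d * (1 - d ^ 2) :=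
    (dvd_sub_comm.1 (Int.eight_dvd_sq_sub_one_of_odd hd)).mul_left d
  have h3 := three_dvd_mul_one_sub_sq d
  omega

/-- The exponent of `exp (2πi / 24)` in the multiplier of the eta function at `(a, b; c, d)`, for
odd positive `d`. -/
def etaExponent (a b c d : ℤ) : ℤ := a * c * (1 - d ^ 2) + d * (b - c + 3) - 3

/-- The matrix `(1, 0; k, 1)`. -/
def lowerUnipotent (k : ℤ) : SL(2, ℤ) := ⟨!![1, 0; k, 1], by simp [Matrix.det_fin_two_of]⟩

lemma coe_lowerUnipotent (k : ℤ) : (lowerUnipotent k : Matrix (Fin 2) (Fin 2) ℤ) = !![1, 0; k, 1] :=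
  rfl

lemma mul_lowerUnipotent_apply_zero (γ : SL(2, ℤ)) (k : ℤ) (i : Fin 2) :
    (γ * lowerUnipotent k) i 0 = γ i 0 + k * γ i 1 := by
  simp [coe_lowerUnipotent, Matrix.mul_apply, mul_comm k]

lemma mul_lowerUnipotent_apply_one (γ : SL(2, ℤ)) (k : ℤ) (i : Fin 2) :
    (γ * lowerUnipotent k) i 1 = γ i 1 := by
  simp [coe_lowerUnipotent, Matrix.mul_apply]

lemma lowerUnipotent_add (k l : ℤ) :
    lowerUnipotent (k + l) = lowerUnipotent k * lowerUnipotent l := by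
  ext i j
  fin_cases j <;> fin_cases i <;>
    simp [mul_lowerUnipotent_apply_zero, mul_lowerUnipotent_apply_one, coe_lowerUnipotent]

lemma mul_T_zpow_apply_zero (γ : SL(2, ℤ)) (k : ℤ) (i : Fin 2) : (γ * T ^ k) i 0 = γ i 0 := by
  simp [coe_T_zpow, Matrix.mul_apply]

lemma mul_T_zpow_apply_one (γ : SL(2, ℤ)) (k : ℤ) (i : Fin 2) :
    (γ * T ^ k) i 1 = γ i 1 + k * γ i 0 := by
  simp [coe_T_zpow, Matrix.mul_apply, add_comm, mul_comm k]

lemma det_eq_one (γ : SL(2, ℤ)) : γ 0 0 * γ 1 1 - γ 0 1 * γ 1 0 = 1 := by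
  rw [← Matrix.det_fin_two, γ.det_coe]

/-- The multiplier of the eta function at a matrix whose lower right entry is odd and positive. -/
noncomputable def etaMultiplier (γ : SL(2, ℤ)) : ℂ :=
  (J(γ 1 0 | (γ 1 1).natAbs) : ℂ) * zeta24 ^ etaExponent (γ 0 0) (γ 0 1) (γ 1 0) (γ 1 1)

lemma twentyFour_dvd_etaExponent_add_left {a b c d : ℤ} (h : a * d - b * c = 1) (hd : Odd d) :
    24 ∣ etaExponent (a + b) b (c + d) d - (etaExponent a b c d - 1) := by
  have : etaExponent (a + b) b (c + d) d - (etaExponent a b c d - 1) =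
      d * (1 - d ^ 2) * (2 * a + b) := by
    simp only [etaExponent]
    linear_combination (d ^ 2 - 1) * h
  exact this ▸ (twentyFour_dvd_mul_one_sub_sq hd).mul_right _

lemma eight_dvd_of_det_eq_one {a b u v : ℤ} (h : a * (2 * v - 1) - b * (2 * u) = 1) :
    8 ∣ 2 * u * (1 - (2 * u) ^ 2) * (a + 2 * b) + 3 * (2 * u * (1 - 2 * u) - 4 * (u * v)) := by
  have ha : Odd (a * (2 * v - 1)) := ⟨b * u, by linear_combination h⟩
  obtain ⟨k, rfl⟩ := (Int.odd_mul.1 ha).1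
  obtain ⟨w, hw⟩ := Int.even_mul_pred_self u
  refine ⟨u * v * (k + 1) - (b - 1) * w + u - 2 * u ^ 2 - 2 * u * v -
    u ^ 3 * (2 * k + 1 + 2 * b), ?_⟩
  linear_combination -2 * u * h - 4 * (b - 1) * hw

lemma twentyFour_dvd_etaExponent_add_right {a b u v : ℤ} (h : a * (2 * v - 1) - b * (2 * u) = 1) :
    24 ∣ etaExponent a (a + b) (2 * u) (2 * u + (2 * v - 1)) -
      (12 * (u * v) + etaExponent a b (2 * u) (2 * v - 1) + 1) := by
  have hdiff : etaExponent a (a + b) (2 * u) (2 * u + (2 * v - 1)) -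
      (12 * (u * v) + etaExponent a b (2 * u) (2 * v - 1) + 1) =
        2 * u * (1 - (2 * u) ^ 2) * (a + 2 * b) + 3 * (2 * u * (1 - 2 * u) - 4 * (u * v)) := by
    simp only [etaExponent]
    linear_combination (1 - 2 * (2 * u) ^ 2) * h
  have h3 := ((three_dvd_mul_one_sub_sq (2 * u)).mul_right (a + 2 * b)).add
    (dvd_mul_right 3 (2 * u * (1 - 2 * u) - 4 * (u * v)))
  have h8 := eight_dvd_of_det_eq_one h
  omega

lemma etaMultiplier_mul_lowerUnipotent_one {γ : SL(2, ℤ)} (hd : Odd (γ 1 1)) :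
    etaMultiplier (γ * lowerUnipotent 1) = etaMultiplier γ * zeta24⁻¹ := by
  have hJ : J(γ 1 0 + γ 1 1 | (γ 1 1).natAbs) = J(γ 1 0 | (γ 1 1).natAbs) :=
    jacobiSym.mod_left' (by
      rw [Int.natCast_natAbs, Int.emod_abs, Int.emod_abs, Int.add_emod_right])
  have hE := zeta24_zpow_congr (twentyFour_dvd_etaExponent_add_left (det_eq_one γ) hd)
  simp only [etaMultiplier, mul_lowerUnipotent_apply_zero, mul_lowerUnipotent_apply_one, one_mul,
    hJ, hE, zpow_sub_one₀ zeta24_ne_zero, mul_assoc]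

lemma etaMultiplier_mul_T {γ : SL(2, ℤ)} (hc : Even (γ 1 0)) (hd : 0 < γ 1 1)
    (hcd : 0 < γ 1 0 + γ 1 1) : etaMultiplier (γ * T) = etaMultiplier γ * zeta24 := by
  obtain ⟨u, hu⟩ := hc.two_dvd
  obtain ⟨v, hv⟩ : ∃ v, γ 1 1 = 2 * v - 1 := by
    have hodd : Odd (γ 0 0 * γ 1 1) := ⟨γ 0 1 * u, by linear_combination det_eq_one γ + γ 0 1 * hu⟩
    obtain ⟨w, hw⟩ := (Int.odd_mul.1 hodd).2
    exact ⟨w + 1, by rw [hw]; ring⟩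
  have hJ : J(2 * u | (2 * u + (2 * v - 1)).natAbs) =
      (u * v).negOnePow * J(2 * u | (2 * v - 1).natAbs) :=
    jacobiSym_add_eq_negOnePow_mul (by omega) (by omega)
  have hE := zeta24_zpow_congr (twentyFour_dvd_etaExponent_add_right (hu ▸ hv ▸ det_eq_one γ))
  have hsq : ((-1 : ℂ) ^ (u * v)) * (-1) ^ (u * v) = 1 := by rw [← mul_zpow]; simp
  have hT := mul_T_zpow_apply_one γ 1
  have hT' := mul_T_zpow_apply_zero γ 1
  simp only [zpow_one, one_mul] at hT hT'
  rw [etaMultiplier, etaMultiplier, hT', hT', hT, hT, hu, hv, add_comm (2 * v - 1),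
    add_comm (γ 0 1), hJ, hE, zpow_add_one₀ zeta24_ne_zero, zpow_add₀ zeta24_ne_zero,
    zeta24_zpow_twelve_mul, Int.cast_mul, Int.cast_negOnePow]
  linear_combination
    J(2 * u | (2 * v - 1).natAbs) * zeta24 ^ etaExponent (γ 0 0) (γ 0 1) (2 * u) (2 * v - 1) *
      zeta24 * hsq

/-! ### The transformation formula of the eta function -/

lemma denom_mul (γ σ : SL(2, ℤ)) (τ : ℍ) :
    denom (γ * σ : SL(2, ℤ)) τ = denom γ ↑(σ • τ) * denom σ τ := by
  rw [map_mul, map_mul, denom_cocycle_σ]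
  simp [UpperHalfPlane.σ]

/-- The transformation formula of the eta function under `γ`. -/
def EtaTransform (γ : SL(2, ℤ)) : Prop :=
  ∀ τ : ℍ, eta ↑(γ • τ) = etaMultiplier γ * Complex.sqrt (denom γ τ) * eta τ

lemma etaTransform_T_zpow (k : ℤ) : EtaTransform (T ^ k) := by
  intro τ
  have hmult : etaMultiplier (T ^ k) = zeta24 ^ k := by
    simp [etaMultiplier, etaExponent, coe_T_zpow]
  have hdenom : denom (T ^ k : SL(2, ℤ)) τ = 1 := by
    rw [ModularGroup.denom_apply]
    simp [coe_T_zpow]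
  rw [hmult, hdenom, coe_T_zpow_smul_eq, eta_add_int, Complex.sqrt_one, mul_one]

lemma coe_lowerUnipotent_one_smul (τ : ℍ) : ↑(lowerUnipotent 1 • τ) = (τ / (τ + 1) : ℂ) := by
  rw [coe_specialLinearGroup_apply]
  simp [coe_lowerUnipotent]

lemma denom_lowerUnipotent_one (τ : ℍ) : denom (lowerUnipotent 1) τ = τ + 1 := by
  simp [ModularGroup.denom_apply, coe_lowerUnipotent]

lemma etaMultiplier_lowerUnipotent_one : etaMultiplier (lowerUnipotent 1) = zeta24⁻¹ := by
  simp [etaMultiplier, etaExponent, coe_lowerUnipotent]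

lemma etaTransform_lowerUnipotent_one : EtaTransform (lowerUnipotent 1) := fun τ ↦ by
  rw [coe_lowerUnipotent_one_smul, denom_lowerUnipotent_one, etaMultiplier_lowerUnipotent_one,
    eta_div_add_one]

lemma etaTransform_mul_iff {γ σ : SL(2, ℤ)} (hσ : EtaTransform σ)
    (hmult : etaMultiplier (γ * σ) = etaMultiplier γ * etaMultiplier σ)
    (hsqrt : ∀ τ : ℍ, Complex.sqrt (denom (γ * σ : SL(2, ℤ)) τ) =
      Complex.sqrt (denom γ ↑(σ • τ)) * Complex.sqrt (denom σ τ)) :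
    EtaTransform (γ * σ) ↔ EtaTransform γ := by
  have key (τ : ℍ) : etaMultiplier (γ * σ) * Complex.sqrt (denom (γ * σ : SL(2, ℤ)) τ) * eta τ =
      etaMultiplier γ * Complex.sqrt (denom γ ↑(σ • τ)) * eta ↑(σ • τ) := by
    rw [hσ τ, hmult, hsqrt]
    ring
  simp only [EtaTransform, key, mul_smul]
  exact ⟨fun H τ ↦ by simpa using H (σ⁻¹ • τ), fun H τ ↦ H (σ • τ)⟩

lemma etaTransform_mul_T_iff {γ : SL(2, ℤ)} (hc : Even (γ 1 0)) (hd : 0 < γ 1 1)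
    (hcd : 0 < γ 1 0 + γ 1 1) : EtaTransform (γ * T) ↔ EtaTransform γ := by
  have hT : etaMultiplier T = zeta24 := by simp [etaMultiplier, etaExponent, coe_T]
  refine etaTransform_mul_iff (zpow_one T ▸ etaTransform_T_zpow 1)
    (hT ▸ etaMultiplier_mul_T hc hd hcd) fun τ ↦ ?_
  have hdenom : denom T τ = 1 := by
    rw [ModularGroup.denom_apply]
    simp [coe_T]
  rw [denom_mul, hdenom, mul_one, Complex.sqrt_one, mul_one]

lemma sqrt_denom_mul_lowerUnipotent_one {γ : SL(2, ℤ)} (hd : 0 < γ 1 1) (τ : ℍ) :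
    Complex.sqrt (denom (γ * lowerUnipotent 1 : SL(2, ℤ)) τ) =
      Complex.sqrt (denom γ ↑(lowerUnipotent 1 • τ)) *
        Complex.sqrt (denom (lowerUnipotent 1) τ) := by
  have hd' : (0 : ℝ) < γ 1 1 := mod_cast hd
  rw [denom_mul]
  apply sqrt_mul
  · by_cases hc : γ 1 0 = 0
    · left
      simpa [ModularGroup.denom_apply, hc]
    · right
      rw [ModularGroup.denom_apply]
      simpa using ⟨hc, (lowerUnipotent 1 • τ).im_ne_zero⟩
  · simpa [denom_lowerUnipotent_one] using τ.im_pos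
  · intro hc
    rw [← denom_mul]
    rw [ModularGroup.denom_apply] at hc ⊢
    rw [mul_lowerUnipotent_apply_zero, mul_lowerUnipotent_apply_one]
    have := pos_of_mul_pos_left (by simpa using hc) (lowerUnipotent 1 • τ).im_pos.le
    simpa using mul_pos (add_pos this hd') τ.im_pos

lemma etaTransform_mul_lowerUnipotent_iff {γ : SL(2, ℤ)} (hd : Odd (γ 1 1)) (hd0 : 0 < γ 1 1)
    (k : ℤ) : EtaTransform (γ * lowerUnipotent k) ↔ EtaTransform γ := by
  have hstep (k : ℤ) :
      EtaTransform (γ * lowerUnipotent (k + 1)) ↔ EtaTransform (γ * lowerUnipotent k) := by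
    have hd' : (γ * lowerUnipotent k) 1 1 = γ 1 1 := mul_lowerUnipotent_apply_one γ k 1
    rw [lowerUnipotent_add, ← mul_assoc]
    exact etaTransform_mul_iff etaTransform_lowerUnipotent_one
      (etaMultiplier_lowerUnipotent_one ▸ etaMultiplier_mul_lowerUnipotent_one (hd' ▸ hd))
      (sqrt_denom_mul_lowerUnipotent_one (hd' ▸ hd0))
  induction k using Int.induction_on with
  | zero =>
    have : lowerUnipotent 0 = 1 := by simpa using lowerUnipotent_add 0 0
    rw [this, mul_one]
  | succ n ih => exact (hstep _).trans ih
  | pred n ih => exact (hstep _).symm.trans (by rwa [sub_add_cancel])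

lemma etaTransform_of_lower_left_eq_zero {γ : SL(2, ℤ)} (hc : γ 1 0 = 0) (hd : 0 < γ 1 1) :
    EtaTransform γ := by
  have hdet : γ 0 0 * γ 1 1 = 1 := by simpa [hc] using det_eq_one γ
  have hd1 : γ 1 1 = 1 := Int.eq_one_of_mul_eq_one_left hd.le hdet
  have ha1 : γ 0 0 = 1 := by simpa [hd1] using hdet
  have hγ : T ^ γ 0 1 = γ := by
    ext i j
    fin_cases i <;> fin_cases j <;> simp [coe_T_zpow, hc, hd1, ha1]
  exact hγ ▸ etaTransform_T_zpow (γ 0 1)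

lemma exists_even_add_mul_abs_lt {c d : ℤ} (hd : Odd d) (hd0 : 0 < d) :
    ∃ k, Even (c + k * d) ∧ |c + k * d| < d := by
  have hmod : c + -(c / d) * d = c % d := by linear_combination -Int.emod_add_mul_ediv c d
  have hnonneg := Int.emod_nonneg c hd0.ne'
  have hlt := Int.emod_lt_of_pos c hd0
  rcases Int.even_or_odd (c % d) with he | ho
  · exact ⟨-(c / d), hmod ▸ he, by rwa [hmod, abs_of_nonneg hnonneg]⟩
  · have hmod' : c + (-(c / d) - 1) * d = c % d - d := by linear_combination hmod
    refine ⟨-(c / d) - 1, hmod' ▸ ho.sub_odd hd, ?_⟩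
    have : c % d ≠ 0 := fun h0 ↦ by simp [h0] at ho
    rw [hmod', abs_lt]
    omega

-- Induction on the lower right entry `d`, a Euclidean algorithm: a lower unipotent matrix makes
-- `c` even and `|c| < d`, after which a power of `T` makes `d` smaller but keeps it odd.
theorem etaTransform_of_odd {γ : SL(2, ℤ)} (hd : Odd (γ 1 1)) (hd0 : 0 < γ 1 1) :
    EtaTransform γ := by
  obtain ⟨n, hn⟩ : ∃ n : ℕ, γ 1 1 = n := Int.eq_ofNat_of_zero_le hd0.le
  induction n using Nat.strong_induction_on generalizing γ with
  | _ n ih =>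
  obtain ⟨k, hk, hlt⟩ := exists_even_add_mul_abs_lt (c := γ 1 0) hd hd0
  rw [← etaTransform_mul_lowerUnipotent_iff hd hd0 k]
  rw [← mul_lowerUnipotent_apply_zero] at hk hlt
  rw [← mul_lowerUnipotent_apply_one γ k 1] at hd hd0 hn hlt
  generalize γ * lowerUnipotent k = δ at *
  rw [abs_lt] at hlt
  have hT (σ : SL(2, ℤ)) : (σ * T) 1 1 = σ 1 1 + σ 1 0 := by
    simpa using mul_T_zpow_apply_one σ 1 1
  rcases lt_trichotomy (δ 1 0) 0 with hc | hc | hc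
  · rw [← etaTransform_mul_T_iff hk hd0 (by omega)]
    refine ih ((δ * T) 1 1).toNat ?_ ?_ ?_ ?_ <;> rw [hT]
    · omega
    · exact hd.add_even hk
    · omega
    · omega
  · exact etaTransform_of_lower_left_eq_zero hc hd0
  · obtain ⟨σ, rfl⟩ : ∃ σ, δ = σ * T := ⟨δ * T⁻¹, by simp⟩
    have hT0 : (σ * T) 1 0 = σ 1 0 := by simpa using mul_T_zpow_apply_zero σ 1 1
    rw [hT0] at hk hlt hc
    rw [hT] at hd hd0 hn hlt
    have hσ : Odd (σ 1 1) := (Int.odd_add.1 hd).2 hk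
    rw [etaTransform_mul_T_iff hk (by omega) (by omega)]
    exact ih (σ 1 1).toNat (by omega) hσ (by omega) (by omega)

/-! ### Invariance of eta quotients -/

section Invariance

variable {ι : Type*} {s : Finset ι} {δ : ι → ℕ} {r : ι → ℤ} {N : ℕ}

/-- The eta quotient `∏ η(δ_i τ) ^ r_i`, the product being over `i ∈ s`. -/
noncomputable def etaQuotient (s : Finset ι) (δ : ι → ℕ) (r : ι → ℤ) (τ : ℍ) : ℂ :=
  ∏ i ∈ s, eta (δ i * τ) ^ r i

/-- The conditions of Gordon, Hughes and Newman under which the eta quotient `∏ η(δ_i τ) ^ r_i` is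
a modular function on `Γ₀(N)`. The classical requirement that `∏ δ_i ^ r_i` be a square of a
rational number is stated with the exponents `|r_i|`, which keeps the product an integer. -/
structure NewmanConditions (N : ℕ) (s : Finset ι) (δ : ι → ℕ) (r : ι → ℤ) : Prop where
  ne_zero : N ≠ 0
  dvd : ∀ i ∈ s, δ i ∣ N
  sum_eq_zero : ∑ i ∈ s, r i = 0
  dvd_sum_mul : 24 ∣ ∑ i ∈ s, r i * δ i
  dvd_sum_mul_div : 24 ∣ ∑ i ∈ s, r i * (N / δ i : ℕ)
  isSquare_prod : IsSquare (∏ i ∈ s, δ i ^ (r i).natAbs)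

lemma NewmanConditions.pos (h : NewmanConditions N s δ r) : ∀ i ∈ s, 0 < δ i :=
  fun i hi ↦ Nat.pos_of_dvd_of_pos (h.dvd i hi) (Nat.pos_of_ne_zero h.ne_zero)

lemma eta_mul_smul {γ : SL(2, ℤ)} (hd : Odd (γ 1 1)) (hd0 : 0 < γ 1 1) {m : ℕ} (hm : 0 < m)
    {c : ℤ} (hc : γ 1 0 = c * m) (τ : ℍ) :
    eta (m * ↑(γ • τ)) =
      J(c | (γ 1 1).natAbs) * zeta24 ^ etaExponent (γ 0 0) (γ 0 1 * m) c (γ 1 1) *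
        Complex.sqrt (denom γ τ) * eta (m * τ) := by
  let γ' : SL(2, ℤ) := ⟨!![γ 0 0, γ 0 1 * m; c, γ 1 1], by
    rw [Matrix.det_fin_two_of]
    linear_combination det_eq_one γ + γ 0 1 * hc⟩
  let τ' : ℍ := ⟨m * τ, by simpa using mul_pos (Nat.cast_pos.2 hm) τ.im_pos⟩
  have hsmul : (↑(γ' • τ') : ℂ) = m * ↑(γ • τ) := by
    rw [coe_specialLinearGroup_apply, coe_specialLinearGroup_apply]
    simp [γ', τ', hc]
    ring
  have hdenom : denom γ' τ' = denom γ τ := by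
    rw [ModularGroup.denom_apply, ModularGroup.denom_apply]
    simp [γ', τ', hc]
    ring
  rw [← hsmul, etaTransform_of_odd (γ := γ') hd hd0 τ', hdenom]
  rfl

lemma prod_zpow_eq_zpow_sum {K : Type*} [Field K] {x : K} (hx : x ≠ 0) (s : Finset ι)
    (f : ι → ℤ) : ∏ i ∈ s, x ^ f i = x ^ ∑ i ∈ s, f i := by
  classical
  induction s using Finset.induction_on with
  | empty => simp
  | insert i s hi ih => rw [Finset.prod_insert hi, Finset.sum_insert hi, ih, zpow_add₀ hx]

lemma jacobiSym_prod (s : Finset ι) (f : ι → ℤ) (n : ℕ) :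
    J(∏ i ∈ s, f i | n) = ∏ i ∈ s, J(f i | n) := by
  classical
  induction s using Finset.induction_on with
  | empty => simp
  | insert i s hi ih => rw [Finset.prod_insert hi, Finset.prod_insert hi, jacobiSym.mul_left, ih]

lemma zpow_eq_pow_natAbs_of_sq_eq_one {K : Type*} [DivisionRing K] {x : K} (hx : x ^ 2 = 1)
    (k : ℤ) : x ^ k = x ^ k.natAbs := by
  cases k with
  | ofNat n => simp
  | negSucc n =>
    have hinv : x⁻¹ = x := inv_eq_of_mul_eq_one_left (by rwa [← sq])
    rw [zpow_negSucc, ← inv_pow, hinv, Int.natAbs_negSucc]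

lemma prod_jacobiSym_zpow_eq_one {n : ℕ} (hcop : ∀ i ∈ s, (δ i).Coprime n)
    (hsq : IsSquare (∏ i ∈ s, δ i ^ (r i).natAbs)) :
    ∏ i ∈ s, (J(δ i | n) : ℂ) ^ r i = 1 := by
  have hpow : ∀ i ∈ s, (J(δ i | n) : ℂ) ^ r i = (J((δ i : ℤ) ^ (r i).natAbs | n) : ℤ) := by
    intro i hi
    have hsq : (J(δ i | n) : ℂ) ^ 2 = 1 := mod_cast
      jacobiSym.sq_one ((Int.gcd_natCast_natCast _ _).trans (hcop i hi))
    rw [jacobiSym.pow_left, Int.cast_pow, zpow_eq_pow_natAbs_of_sq_eq_one hsq]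
  obtain ⟨m, hm⟩ := hsq
  have hmn : m.Coprime n := by
    refine Nat.Coprime.coprime_mul_right (k := m) ?_
    rw [← hm]
    exact Nat.Coprime.prod_left fun i hi ↦ (hcop i hi).pow_left _
  rw [Finset.prod_congr rfl hpow, ← Int.cast_prod, ← jacobiSym_prod]
  have hm' : ∏ i ∈ s, (δ i : ℤ) ^ (r i).natAbs = (m : ℤ) ^ 2 :=
    mod_cast hm.trans (sq m).symm
  rw [hm', jacobiSym.sq_one' ((Int.gcd_natCast_natCast _ _).trans hmn), Int.cast_one]

lemma sum_etaExponent_mul (a b c d : ℤ) (h : ∑ i ∈ s, r i = 0) :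
    ∑ i ∈ s, etaExponent a (b * δ i) (c * (N / δ i : ℕ)) d * r i =
      (a * c * (1 - d ^ 2) - d * c) * ∑ i ∈ s, r i * (N / δ i : ℕ) +
        d * b * ∑ i ∈ s, r i * δ i := by
  have hsum : ∑ i ∈ s, etaExponent a (b * δ i) (c * (N / δ i : ℕ)) d * r i =
      (a * c * (1 - d ^ 2) - d * c) * ∑ i ∈ s, r i * (N / δ i : ℕ) +
        d * b * ∑ i ∈ s, r i * δ i + (3 * d - 3) * ∑ i ∈ s, r i := by
    simp only [Finset.mul_sum, ← Finset.sum_add_distrib, etaExponent]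
    exact Finset.sum_congr rfl fun i _ ↦ by ring
  rw [hsum, h, mul_zero, add_zero]

lemma NewmanConditions.prod_jacobiSym_zpow (h : NewmanConditions N s δ r) {c : ℤ} {n : ℕ}
    (hcop : IsCoprime (c * N) (n : ℤ)) :
    ∏ i ∈ s, (J(c * (N / δ i : ℕ) | n) : ℂ) ^ r i = 1 := by
  have hJ0 : (J(c * N | n) : ℂ) ≠ 0 := by
    exact_mod_cast jacobiSym.ne_zero (Int.isCoprime_iff_gcd_eq_one.1 hcop)
  have hδ : ∀ i ∈ s, (δ i).Coprime n := fun i hi ↦ Nat.isCoprime_iff_coprime.1 <|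
    hcop.of_isCoprime_of_dvd_left <| (Int.natCast_dvd_natCast.2 (h.dvd i hi)).mul_left c
  have hmul : ∀ i ∈ s, (J(c * (N / δ i : ℕ) | n) : ℂ) ^ r i * (J(δ i | n) : ℂ) ^ r i =
      (J(c * N | n) : ℂ) ^ r i := by
    intro i hi
    rw [← mul_zpow, ← Int.cast_mul, ← jacobiSym.mul_left, mul_assoc, ← Nat.cast_mul,
      Nat.div_mul_cancel (h.dvd i hi)]
  calc ∏ i ∈ s, (J(c * (N / δ i : ℕ) | n) : ℂ) ^ r i
    _ = ∏ i ∈ s, (J(c * (N / δ i : ℕ) | n) : ℂ) ^ r i * (J(δ i | n) : ℂ) ^ r i := by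
      rw [Finset.prod_mul_distrib, prod_jacobiSym_zpow_eq_one hδ h.isSquare_prod, mul_one]
    _ = ∏ i ∈ s, (J(c * N | n) : ℂ) ^ r i := Finset.prod_congr rfl hmul
    _ = 1 := by rw [prod_zpow_eq_zpow_sum hJ0, h.sum_eq_zero, zpow_zero]

lemma NewmanConditions.etaQuotient_smul_of_odd (h : NewmanConditions N s δ r) {γ : SL(2, ℤ)}
    (hγ : γ ∈ Gamma0 N) (hd : Odd (γ 1 1)) (hd0 : 0 < γ 1 1) (τ : ℍ) :
    etaQuotient s δ r (γ • τ) = etaQuotient s δ r τ := by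
  obtain ⟨c, hc⟩ : ∃ c : ℤ, γ 1 0 = c * N := by
    obtain ⟨c, hc⟩ := (ZMod.intCast_zmod_eq_zero_iff_dvd _ _).1 (Gamma0_mem.1 hγ)
    exact ⟨c, hc.trans (mul_comm _ _)⟩
  have hsqrt : Complex.sqrt (denom γ τ) ≠ 0 :=
    sqrt_eq_exp (denom_ne_zero γ τ) ▸ exp_ne_zero _
  have hcop : IsCoprime (c * N) ((γ 1 1).natAbs : ℤ) := by
    rw [← hc, Int.natAbs_of_nonneg hd0.le]
    exact bottom_row_coprime γ
  have hfactor : ∀ i ∈ s, eta (δ i * ↑(γ • τ)) ^ r i =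
      (J(c * (N / δ i : ℕ) | (γ 1 1).natAbs) : ℂ) ^ r i *
        zeta24 ^ (etaExponent (γ 0 0) (γ 0 1 * δ i) (c * (N / δ i : ℕ)) (γ 1 1) * r i) *
        Complex.sqrt (denom γ τ) ^ r i * eta (δ i * τ) ^ r i := by
    intro i hi
    have hci : γ 1 0 = c * (N / δ i : ℕ) * δ i := by
      rw [hc, mul_assoc, ← Nat.cast_mul, Nat.div_mul_cancel (h.dvd i hi)]
    rw [eta_mul_smul hd hd0 (h.pos i hi) hci, mul_zpow, mul_zpow, mul_zpow, zpow_mul]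
  have hexp : 24 ∣ ∑ i ∈ s,
      etaExponent (γ 0 0) (γ 0 1 * δ i) (c * (N / δ i : ℕ)) (γ 1 1) * r i := by
    rw [sum_etaExponent_mul _ _ _ _ h.sum_eq_zero]
    exact dvd_add (h.dvd_sum_mul_div.mul_left _) (h.dvd_sum_mul.mul_left _)
  rw [etaQuotient, Finset.prod_congr rfl hfactor, Finset.prod_mul_distrib, Finset.prod_mul_distrib,
    Finset.prod_mul_distrib, h.prod_jacobiSym_zpow hcop, prod_zpow_eq_zpow_sum zeta24_ne_zero,
    zeta24_zpow_eq_one hexp, prod_zpow_eq_zpow_sum hsqrt, h.sum_eq_zero, zpow_zero, one_mul,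
    one_mul, one_mul, etaQuotient]

lemma smul_eq_of_odd_of_pos {α : Type*} {Γ : Subgroup SL(2, ℤ)} (hT : T ∈ Γ) (hneg : -1 ∈ Γ)
    {f : ℍ → α} (hf : ∀ γ ∈ Γ, Odd (γ 1 1) → 0 < γ 1 1 → ∀ τ : ℍ, f (γ • τ) = f τ)
    {γ : SL(2, ℤ)} (hγ : γ ∈ Γ) (τ : ℍ) : f (γ • τ) = f τ := by
  have hodd : ∀ γ ∈ Γ, Odd (γ 1 1) → ∀ τ : ℍ, f (γ • τ) = f τ := by
    intro γ hγ hd τ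
    rcases lt_trichotomy (γ 1 1) 0 with h | h | h
    · have := hf (-γ) (neg_one_mul γ ▸ mul_mem hneg hγ) (by simpa using hd) (by simpa using h) τ
      rwa [SL_neg_smul] at this
    · simp [h] at hd
    · exact hf γ hγ hd h τ
  rcases Int.even_or_odd (γ 1 1) with he | ho
  · have hdet : Odd (γ 0 0 * γ 1 1 - γ 0 1 * γ 1 0) := by simp only [det_eq_one, odd_one]
    have hc : Odd (γ 1 0) := (Int.odd_mul.1 ((Int.odd_sub'.1 hdet).2 (he.mul_left _))).2
    have hγT : Odd ((γ * T) 1 1) := by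
      have := mul_T_zpow_apply_one γ 1 1
      rw [zpow_one, one_mul] at this
      exact this ▸ he.add_odd hc
    have h1 := hodd (γ * T) (mul_mem hγ hT) hγT (T⁻¹ • τ)
    have h2 := hodd T hT (by simp [coe_T]) (T⁻¹ • τ)
    rw [mul_smul, smul_inv_smul] at h1
    rw [smul_inv_smul] at h2
    rw [h1, h2]
  · exact hodd γ hγ ho τ

lemma NewmanConditions.etaQuotient_smul (h : NewmanConditions N s δ r) {γ : SL(2, ℤ)}
    (hγ : γ ∈ Gamma0 N) (τ : ℍ) : etaQuotient s δ r (γ • τ) = etaQuotient s δ r τ :=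
  smul_eq_of_odd_of_pos (by simp [coe_T]) (by simp) (fun _ ↦ h.etaQuotient_smul_of_odd) hγ τ

end Invariance

/-! ### Growth of eta quotients at the cusps -/

/-- `f` grows at most exponentially in `Im τ` at `i∞`, that is, it has at most a pole there. -/
def IsExpBoundedAtImInfty {E : Type*} [Norm E] (f : ℍ → E) : Prop :=
  ∃ B : ℝ, f =O[atImInfty] fun τ ↦ Real.exp (B * τ.im)

namespace IsExpBoundedAtImInfty

variable {f g : ℍ → ℝ}

lemma of_isBigO_one (hf : f =O[atImInfty] fun _ ↦ (1 : ℝ)) : IsExpBoundedAtImInfty f :=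
  ⟨0, by simpa using hf⟩

lemma const_mul (hf : IsExpBoundedAtImInfty f) (c : ℝ) : IsExpBoundedAtImInfty fun τ ↦ c * f τ :=
  hf.imp fun _ h ↦ h.const_mul_left c

lemma prod {ι : Type*} {s : Finset ι} {f : ι → ℍ → ℝ}
    (hf : ∀ i ∈ s, IsExpBoundedAtImInfty (f i)) :
    IsExpBoundedAtImInfty fun τ ↦ ∏ i ∈ s, f i τ := by
  choose! B hB using hf
  refine ⟨∑ i ∈ s, B i, ?_⟩
  simp only [Finset.sum_mul, Real.exp_sum]
  exact IsBigO.finsetProd hB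

lemma pow (hf : IsExpBoundedAtImInfty f) (n : ℕ) : IsExpBoundedAtImInfty fun τ ↦ f τ ^ n := by
  simpa using prod (s := Finset.range n) fun _ _ ↦ hf

lemma zpow (hf : IsExpBoundedAtImInfty f) (hf' : IsExpBoundedAtImInfty fun τ ↦ (f τ)⁻¹) (n : ℤ) :
    IsExpBoundedAtImInfty fun τ ↦ f τ ^ n := by
  cases n with
  | ofNat n => simpa using hf.pow n
  | negSucc n => simpa using hf'.pow (n + 1)

lemma comp_of_im_eq_mul (hf : IsExpBoundedAtImInfty f) {t : ℍ → ℍ} {κ : ℝ} (hκ : 0 < κ)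
    (ht : ∀ τ, (t τ).im = κ * τ.im) : IsExpBoundedAtImInfty fun τ ↦ f (t τ) := by
  obtain ⟨B, hB⟩ := hf
  have htend : Tendsto t atImInfty atImInfty := by
    rw [atImInfty, tendsto_comap_iff, show UpperHalfPlane.im ∘ t = fun τ ↦ κ * τ.im from funext ht]
    exact tendsto_comap.const_mul_atTop hκ
  exact ⟨B * κ, by simpa only [Function.comp_def, ht, mul_assoc] using hB.comp_tendsto htend⟩

lemma of_norm_pow {E : Type*} [NormedAddCommGroup E] {f : ℍ → E} {n : ℕ} (hn : n ≠ 0)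
    (hf : IsExpBoundedAtImInfty fun τ ↦ ‖f τ‖ ^ n) : IsExpBoundedAtImInfty f := by
  obtain ⟨B, hB⟩ := hf
  have hn' : (n : ℝ) ≠ 0 := mod_cast hn
  have hroot (τ : ℍ) : Real.exp (B * τ.im) = Real.exp (B / n * τ.im) ^ n := by
    rw [← Real.exp_nat_mul]
    congr 1
    field_simp
  simp only [hroot] at hB
  exact ⟨B / n, (IsBigO.of_pow hn hB).of_norm_left⟩

end IsExpBoundedAtImInfty

lemma isExpBoundedAtImInfty_norm_discriminant :
    IsExpBoundedAtImInfty fun τ ↦ ‖discriminant τ‖ :=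
  .of_isBigO_one (discriminant_isZeroAtImInfty.isBigO_one ℝ).norm_left

lemma isExpBoundedAtImInfty_inv_norm_discriminant :
    IsExpBoundedAtImInfty fun τ ↦ ‖discriminant τ‖⁻¹ := by
  refine ⟨2 * π, ?_⟩
  have := exp_isBigO_discriminant.norm_right.inv_rev (by simp [Real.exp_ne_zero])
  simpa [← Real.exp_neg] using this

lemma norm_discriminant_smul_mul_im_pow (γ : SL(2, ℤ)) (τ : ℍ) :
    ‖discriminant (γ • τ)‖ * (γ • τ).im ^ 6 = ‖discriminant τ‖ * τ.im ^ 6 := by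
  have hslash := congrFun
    (SlashInvariantForm.slash_action_generators_SL2Z discriminant_S_invariant
      discriminant_T_invariant γ) τ
  have hdenom : ‖denom γ τ‖ ≠ 0 := norm_ne_zero_iff.2 (denom_ne_zero γ τ)
  rw [SL_slash_apply] at hslash
  rw [← hslash, norm_mul, ModularGroup.im_smul_eq_div_normSq, norm_zpow, div_pow,
    Complex.normSq_eq_norm_sq, ← pow_mul, zpow_neg]
  field_simp

lemma exists_lower_row_mul_add_mul_eq_zero {a c : ℤ} (h : c = 0 → a ≠ 0) :
    ∃ γ : SL(2, ℤ), γ 1 0 * a + γ 1 1 * c = 0 := by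
  have hgcd : 0 < Int.gcd a c := Int.gcd_pos_iff.2 (by tauto)
  obtain ⟨A, x, y, -, hxy, hx, hy⟩ := Int.exists_gcd_one' hgcd
  obtain ⟨γ, -, hγ⟩ := ModularGroup.bottom_row_surj (R := ℤ)
    (show ![-y, x] ∈ {cd : Fin 2 → ℤ | IsCoprime (cd 0) (cd 1)} by
      simpa [IsCoprime.neg_left_iff] using (Int.isCoprime_iff_gcd_eq_one.2 hxy).symm)
  have hγ0 : γ 1 0 = -y := congrFun hγ 0
  have hγ1 : γ 1 1 = x := congrFun hγ 1
  exact ⟨γ, by rw [hγ0, hγ1, hx, hy]; ring⟩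

lemma coe_smul_mul_denom (γ : SL(2, ℤ)) (τ : ℍ) :
    ↑(γ • τ) * denom γ τ = γ 0 0 * τ + γ 0 1 := by
  have hne := denom_ne_zero γ τ
  rw [ModularGroup.denom_apply] at hne ⊢
  rw [coe_specialLinearGroup_apply]
  exact div_mul_cancel₀ _ hne

-- The matrix `γ'` makes the integral matrix `γ' * (m, 0; 0, 1) * γ` upper triangular.
lemma exists_im_smul_eq_mul_im (γ : SL(2, ℤ)) {m : ℕ} (hm : 0 < m) :
    ∃ γ' : SL(2, ℤ), ∃ κ > 0, ∀ τ w : ℍ, (w : ℂ) = m * ↑(γ • τ) → (γ' • w).im = κ * τ.im := by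
  obtain ⟨γ', hγ'⟩ : ∃ γ' : SL(2, ℤ), γ' 1 0 * (m * γ 0 0) + γ' 1 1 * γ 1 0 = 0 := by
    refine exists_lower_row_mul_add_mul_eq_zero fun hc ↦ mul_ne_zero (mod_cast hm.ne') fun ha ↦ ?_
    simpa [ha, hc] using det_eq_one γ
  set D : ℤ := γ' 1 0 * (m * γ 0 1) + γ' 1 1 * γ 1 1 with hD
  have hdenom (τ w : ℍ) (hw : (w : ℂ) = m * ↑(γ • τ)) : denom γ' w * denom γ τ = D := by
    have hγ'C : (γ' 1 0 * (m * γ 0 0) + γ' 1 1 * γ 1 0 : ℂ) = 0 := mod_cast hγ'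
    have hsmul := coe_smul_mul_denom γ τ
    rw [ModularGroup.denom_apply] at hsmul ⊢
    rw [ModularGroup.denom_apply, hw, hD]
    push_cast
    linear_combination γ' 1 0 * m * hsmul + τ * hγ'C
  have hD0 : (D : ℝ) ≠ 0 := by
    refine Int.cast_ne_zero.2 fun h ↦ ?_
    have h11 : γ' 1 1 = 0 := by
      linear_combination γ 0 0 * (hD.symm.trans h) - γ 0 1 * hγ' - γ' 1 1 * det_eq_one γ
    have h10 : m * γ' 1 0 = 0 := by
      linear_combination γ 1 1 * hγ' - γ 1 0 * (hD.symm.trans h) - m * γ' 1 0 * det_eq_one γ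
    have h10' : γ' 1 0 = 0 := (mul_eq_zero.1 h10).resolve_left (mod_cast hm.ne')
    simpa [h11, h10'] using det_eq_one γ'
  refine ⟨γ', m / D ^ 2, div_pos (Nat.cast_pos.2 hm) (by positivity), fun τ w hw ↦ ?_⟩
  have hnorm : Complex.normSq (denom γ' w) * Complex.normSq (denom γ τ) = D ^ 2 := by
    rw [← map_mul, hdenom τ w hw, Complex.normSq_intCast, sq]
  have him : w.im = m * (γ • τ).im := by simpa using congrArg Complex.im hw
  rw [ModularGroup.im_smul_eq_div_normSq, him, ModularGroup.im_smul_eq_div_normSq, ← hnorm]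
  field_simp

section Growth

variable {ι : Type*} {s : Finset ι} {δ : ι → ℕ} {r : ι → ℤ}

lemma isExpBoundedAtImInfty_norm_eta_mul_smul_zpow (γ : SL(2, ℤ)) {m : ℕ} (hm : 0 < m) (k : ℤ) :
    IsExpBoundedAtImInfty fun τ : ℍ ↦
      (‖eta (m * ↑(γ • τ))‖ ^ 24 * ((γ • τ).im / τ.im) ^ 6) ^ k := by
  obtain ⟨γ', κ, hκ, him⟩ := exists_im_smul_eq_mul_im γ hm
  have hm0 : (0 : ℝ) < m := mod_cast hm
  let w (τ : ℍ) : ℍ := ⟨m * ↑(γ • τ), by simpa using mul_pos hm0 (γ • τ).im_pos⟩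
  have hfactor (τ : ℍ) : ‖eta (m * ↑(γ • τ))‖ ^ 24 * ((γ • τ).im / τ.im) ^ 6 =
      (κ / m) ^ 6 * ‖discriminant (γ' • w τ)‖ := by
    have hw : (w τ).im = m * (γ • τ).im := by simp [w, ← coe_im]
    have hΔ : ‖discriminant (w τ)‖ = ‖eta (m * ↑(γ • τ))‖ ^ 24 := norm_pow _ _
    have := norm_discriminant_smul_mul_im_pow γ' (w τ)
    rw [him τ (w τ) rfl, hw, hΔ] at this
    field_simp
    linear_combination -this
  have him' (τ : ℍ) : (γ' • w τ).im = κ * τ.im := him τ (w τ) rfl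
  simp only [hfactor]
  refine .zpow ?_ ?_ k
  · exact (isExpBoundedAtImInfty_norm_discriminant.comp_of_im_eq_mul hκ him').const_mul _
  · simp only [mul_inv]
    exact (isExpBoundedAtImInfty_inv_norm_discriminant.comp_of_im_eq_mul hκ him').const_mul _

lemma isExpBoundedAtImInfty_etaQuotient_smul (hδ : ∀ i ∈ s, 0 < δ i) (hr : ∑ i ∈ s, r i = 0)
    (γ : SL(2, ℤ)) : IsExpBoundedAtImInfty fun τ ↦ etaQuotient s δ r (γ • τ) := by
  refine .of_norm_pow (n := 24) (by norm_num) ?_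
  have hweight (τ : ℍ) : ‖etaQuotient s δ r (γ • τ)‖ ^ 24 =
      ∏ i ∈ s, (‖eta (δ i * ↑(γ • τ))‖ ^ 24 * ((γ • τ).im / τ.im) ^ 6) ^ r i := by
    have hne : ((γ • τ).im / τ.im) ^ 6 ≠ 0 :=
      pow_ne_zero _ (div_ne_zero (γ • τ).im_pos.ne' τ.im_pos.ne')
    simp only [mul_zpow, Finset.prod_mul_distrib, prod_zpow_eq_zpow_sum hne, hr, zpow_zero, mul_one,
      etaQuotient, norm_prod, norm_zpow, ← Finset.prod_pow]
    exact Finset.prod_congr rfl fun i _ ↦ mod_cast zpow_comm _ (r i) (24 : ℕ)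
  simp only [hweight]
  exact .prod fun i hi ↦ isExpBoundedAtImInfty_norm_eta_mul_smul_zpow γ (hδ i hi) (r i)

end Growth

/-! ### Fourier expansions at the cusps -/

lemma mdifferentiable_etaQuotient {ι : Type*} {s : Finset ι} {δ : ι → ℕ} (hδ : ∀ i ∈ s, 0 < δ i)
    (r : ι → ℤ) : MDifferentiable 𝓘(ℂ) 𝓘(ℂ) (etaQuotient s δ r) := by
  rw [UpperHalfPlane.mdifferentiable_iff]
  have hdiff : DifferentiableOn ℂ (fun z : ℂ ↦ ∏ i ∈ s, eta (δ i * z) ^ r i) {z | 0 < z.im} := by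
    refine DifferentiableOn.fun_finsetProd fun i hi z hz ↦ ?_
    have hpos : 0 < (δ i * z).im := by simpa using mul_pos (Nat.cast_pos.2 (hδ i hi)) hz
    have heta : DifferentiableAt ℂ (fun z : ℂ ↦ eta (δ i * z)) z :=
      (differentiableAt_eta_of_mem_upperHalfPlaneSet hpos).comp z (by fun_prop)
    exact (heta.zpow (.inl (eta_ne_zero hpos))).differentiableWithinAt
  exact hdiff.congr fun z hz ↦ by simp [etaQuotient, ofComplex_apply_of_im_pos hz]

lemma hasFourierExpansion_of_hasSum {h : ℕ} {f : ℍ → ℂ} (M : ℤ) (p : PowerSeries ℂ)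
    (hp : ∀ τ : ℍ, HasSum (fun m : ℕ ↦ p.coeff m * Function.Periodic.qParam h τ ^ m)
      (f τ * Function.Periodic.qParam h τ ^ (-M))) :
    HasFourierExpansion h f (HahnSeries.single M 1 * (p : LaurentSeries ℂ)) := by
  intro τ
  set q := Function.Periodic.qParam h (τ : ℂ) with hq
  have hq0 : q ≠ 0 := Function.Periodic.qParam_ne_zero _
  have hinj : Function.Injective (fun m : ℕ ↦ (m : ℤ) + M) :=
    (add_left_injective M).comp Nat.cast_injective
  have hsum := (hp τ).mul_right (q ^ M)
  rw [← hq, mul_assoc, ← zpow_add₀ hq0, neg_add_cancel, zpow_zero, mul_one] at hsum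
  rw [← hinj.hasSum_iff]
  · refine hsum.congr_fun fun m ↦ ?_
    simp [HahnSeries.coeff_single_mul, zpow_add₀ hq0, mul_assoc]
  · intro n hn
    have hneg : n - M < 0 := by
      by_contra! hnonneg
      exact hn ⟨(n - M).toNat, by simp only; omega⟩
    rw [HahnSeries.coeff_single_mul, PowerSeries.coeff_coe, if_pos hneg, mul_zero, zero_mul]

lemma periodic_comp_ofComplex {α : Type*} {f : ℍ → α} {h : ℝ} (hf : ∀ τ, f (h +ᵥ τ) = f τ) :
    Function.Periodic (f ∘ ofComplex) h := by
  intro z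
  rw [Function.comp_apply, Function.comp_apply]
  rcases lt_or_ge 0 z.im with hz | hz
  · have hz' : 0 < (z + h).im := by simpa using hz
    rw [ofComplex_apply_of_im_pos hz', ofComplex_apply_of_im_pos hz, ← hf ⟨z, hz⟩]
    congr 1
    ext
    simp [add_comm]
  · have hz' : (z + h).im ≤ 0 := by simpa using hz
    rw [ofComplex_apply_of_im_nonpos hz, ofComplex_apply_of_im_nonpos hz']

lemma exists_isBoundedAtImInfty_mul_qParam_pow {h : ℕ} (hh : 0 < h) {f : ℍ → ℂ}
    (hf : IsExpBoundedAtImInfty f) :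
    ∃ M : ℕ, IsBoundedAtImInfty fun τ ↦ f τ * Function.Periodic.qParam h τ ^ M := by
  obtain ⟨B, hB⟩ := hf
  have hh0 : (0 : ℝ) < h := mod_cast hh
  obtain ⟨M, hM⟩ := exists_nat_ge (B * h / (2 * π))
  have hq := (isBigO_refl (fun τ : ℍ ↦ Function.Periodic.qParam h τ ^ M) atImInfty).norm_right
  refine ⟨M, (hB.mul hq).trans (.of_norm_le fun τ ↦ ?_)⟩
  have hexp : B * τ.im + M * (-2 * π * τ.im / h) = (B * h - M * (2 * π)) * τ.im / h := by
    field_simp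
    ring
  rw [norm_pow, Function.Periodic.norm_qParam, ← Real.exp_nat_mul, ← Real.exp_add, coe_im, hexp,
    Real.norm_of_nonneg (Real.exp_nonneg _), Pi.one_apply, Real.exp_le_one_iff]
  have hBM : B * h ≤ M * (2 * π) := (div_le_iff₀ (by positivity)).1 hM
  exact div_nonpos_of_nonpos_of_nonneg
    (mul_nonpos_of_nonpos_of_nonneg (sub_nonpos.2 hBM) τ.im_pos.le) hh0.le

lemma qParam_periodic {h : ℝ} (hh : h ≠ 0) :
    Function.Periodic (Function.Periodic.qParam h) (h : ℂ) := by
  intro z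
  have hh' : (h : ℂ) ≠ 0 := ofReal_ne_zero.2 hh
  rw [Function.Periodic.qParam, mul_add, add_div, mul_div_cancel_right₀ _ hh']
  exact exp_periodic _

lemma exists_hasFourierExpansion {h : ℕ} (hh : 0 < h) {f : ℍ → ℂ}
    (hf : MDifferentiable 𝓘(ℂ) 𝓘(ℂ) f) (hper : ∀ τ, f ((h : ℝ) +ᵥ τ) = f τ)
    (hgrowth : IsExpBoundedAtImInfty f) : ∃ c, HasFourierExpansion h f c := by
  have hh0 : (0 : ℝ) < h := mod_cast hh
  obtain ⟨M, hM⟩ := exists_isBoundedAtImInfty_mul_qParam_pow hh hgrowth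
  set F : ℍ → ℂ := fun τ ↦ f τ * Function.Periodic.qParam h τ ^ M with hF
  have hperF : Function.Periodic (F ∘ ofComplex) (h : ℝ) := by
    refine periodic_comp_ofComplex fun τ ↦ ?_
    have hq := qParam_periodic hh0.ne' (τ : ℂ)
    rw [hF]
    simp only [hper, coe_vadd, add_comm _ (τ : ℂ), hq]
  have hholF : MDifferentiable 𝓘(ℂ) 𝓘(ℂ) F := by
    refine hf.mul (UpperHalfPlane.mdifferentiable_iff.2 ?_)
    have : DifferentiableOn ℂ (fun z ↦ Function.Periodic.qParam h z ^ M) {z | 0 < z.im} := by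
      fun_prop
    exact this.congr fun z hz ↦ by simp [ofComplex_apply_of_im_pos hz]
  refine ⟨_, hasFourierExpansion_of_hasSum (-M) (qExpansion h F) fun τ ↦ ?_⟩
  simpa [hF] using hasSum_qExpansion hh0 hperF hholF hM τ

lemma smul_vadd_eq_of_gamma0_invariant {α : Type*} {N : ℕ} {f : ℍ → α}
    (hf : ∀ γ ∈ Gamma0 N, ∀ τ : ℍ, f (γ • τ) = f τ) (γ : SL(2, ℤ)) (τ : ℍ) :
    f (γ • ((N : ℝ) +ᵥ τ)) = f (γ • τ) := by
  have hT : T ^ (N : ℤ) ∈ CongruenceSubgroup.Gamma N := by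
    simpa using ModularGroup_T_pow_mem_Gamma N N dvd_rfl
  have hconj := (Gamma_normal N).conj_mem _ hT γ
  have hmem : γ * T ^ (N : ℤ) * γ⁻¹ ∈ Gamma0 N := Gamma0_mem.2 (Gamma_mem.1 hconj).2.2.1
  rw [← hf _ hmem (γ • τ), ← mul_smul, inv_mul_cancel_right, mul_smul, modular_T_zpow_smul,
    Int.cast_natCast]

theorem NewmanConditions.isWeaklyHolomorphicModularFunction {ι : Type*} {s : Finset ι} {δ : ι → ℕ}
    {r : ι → ℤ} {N : ℕ} (h : NewmanConditions N s δ r) :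
    IsWeaklyHolomorphicModularFunction (Gamma0 N) (etaQuotient s δ r) where
  holomorphic := mdifferentiable_etaQuotient h.pos r
  invariant _ hγ τ := h.etaQuotient_smul hγ τ
  meromorphic_at_cusps γ := by
    have hN : 0 < N := Nat.pos_of_ne_zero h.ne_zero
    exact ⟨N, hN, exists_hasFourierExpansion hN
      ((mdifferentiable_etaQuotient h.pos r).comp (mdifferentiable_smul (by simp)))
      (smul_vadd_eq_of_gamma0_invariant (fun _ ↦ h.etaQuotient_smul) γ)
      (isExpBoundedAtImInfty_etaQuotient_smul h.pos h.sum_eq_zero γ)⟩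

/-! ### Rational Taylor coefficients -/

/-- The Taylor series of a function at `0`. -/
noncomputable def taylorSeries (f : ℂ → ℂ) : PowerSeries ℂ :=
  .mk fun n ↦ (n.factorial : ℂ)⁻¹ * iteratedDeriv n f 0

lemma taylorSeries_mul {f g : ℂ → ℂ} (hf : AnalyticAt ℂ f 0) (hg : AnalyticAt ℂ g 0) :
    taylorSeries (f * g) = taylorSeries f * taylorSeries g := by
  ext n
  simp only [taylorSeries, PowerSeries.coeff_mk, iteratedDeriv_mul hf.contDiffAt hg.contDiffAt,
    Finset.mul_sum, PowerSeries.coeff_mul, Finset.Nat.sum_antidiagonal_eq_sum_range_succ_mk,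
    Nat.succ_eq_add_one]
  refine Finset.sum_congr rfl fun i hi ↦ ?_
  rw [Nat.cast_choose _ (by grind)]
  field_simp [Nat.factorial_ne_zero]

lemma taylorSeries_congr {f g : ℂ → ℂ} (h : f =ᶠ[𝓝 0] g) : taylorSeries f = taylorSeries g := by
  ext n
  simp only [taylorSeries, PowerSeries.coeff_mk, h.iteratedDeriv_eq n]

lemma taylorSeries_one : taylorSeries 1 = 1 := by
  ext n
  rw [taylorSeries, PowerSeries.coeff_mk, PowerSeries.coeff_one, Pi.one_def, iteratedDeriv_const]
  split_ifs with h <;> simp [h]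

lemma constantCoeff_taylorSeries (f : ℂ → ℂ) :
    PowerSeries.constantCoeff (taylorSeries f) = f 0 := by
  simp [taylorSeries, ← PowerSeries.coeff_zero_eq_constantCoeff_apply]

lemma hasSum_taylorSeries {f : ℂ → ℂ} {ρ : ℝ} (hf : DifferentiableOn ℂ f (Metric.ball 0 ρ))
    {z : ℂ} (hz : z ∈ Metric.ball 0 ρ) :
    HasSum (fun n ↦ (taylorSeries f).coeff n * z ^ n) (f z) := by
  refine (hasSum_taylorSeries_on_ball hf hz).congr_fun fun n ↦ ?_
  simp [taylorSeries]
  ring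

/-- The function `f` is analytic at `0` and its Taylor coefficients there lie in the field `K`. -/
def HasTaylorSeriesOver (K : Type*) [Field K] [Algebra K ℂ] (f : ℂ → ℂ) : Prop :=
  AnalyticAt ℂ f 0 ∧ ∃ p : PowerSeries K, taylorSeries f = p.map (algebraMap K ℂ)

namespace HasTaylorSeriesOver

variable {K : Type*} [Field K] [Algebra K ℂ] {f g : ℂ → ℂ}

lemma one : HasTaylorSeriesOver K 1 :=
  ⟨analyticAt_const, 1, by rw [taylorSeries_one, map_one]⟩

lemma mul (hf : HasTaylorSeriesOver K f) (hg : HasTaylorSeriesOver K g) :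
    HasTaylorSeriesOver K (f * g) := by
  obtain ⟨hf, p, hp⟩ := hf
  obtain ⟨hg, r, hr⟩ := hg
  exact ⟨hf.mul hg, p * r, by rw [taylorSeries_mul hf hg, hp, hr, map_mul]⟩

lemma inv (hf : HasTaylorSeriesOver K f) (h0 : f 0 ≠ 0) : HasTaylorSeriesOver K f⁻¹ := by
  obtain ⟨hf, p, hp⟩ := hf
  refine ⟨hf.inv h0, p⁻¹, ?_⟩
  have hinv : taylorSeries f⁻¹ * taylorSeries f = 1 := by
    rw [← taylorSeries_mul (hf.inv h0) hf, ← taylorSeries_one]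
    refine taylorSeries_congr ?_
    filter_upwards [hf.continuousAt.eventually_ne h0] with z hz
    simp [hz]
  have hp0 : p.constantCoeff ≠ 0 := by
    rw [← constantCoeff_taylorSeries f, hp, ← PowerSeries.coeff_zero_eq_constantCoeff_apply,
      PowerSeries.coeff_map, PowerSeries.coeff_zero_eq_constantCoeff_apply] at h0
    exact (map_ne_zero _).1 h0
  calc
    taylorSeries f⁻¹ = taylorSeries f⁻¹ * (p * p⁻¹).map (algebraMap K ℂ) := by
      rw [PowerSeries.mul_inv_cancel _ hp0, map_one, mul_one]
    _ = p⁻¹.map (algebraMap K ℂ) := by rw [map_mul, ← hp, ← mul_assoc, hinv, one_mul]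

lemma prod {ι : Type*} {s : Finset ι} {f : ι → ℂ → ℂ}
    (hf : ∀ i ∈ s, HasTaylorSeriesOver K (f i)) : HasTaylorSeriesOver K (∏ i ∈ s, f i) :=
  Finset.prod_induction _ _ (fun _ _ ↦ mul) one hf

lemma pow (hf : HasTaylorSeriesOver K f) (n : ℕ) : HasTaylorSeriesOver K (f ^ n) := by
  simpa using prod (s := Finset.range n) fun _ _ ↦ hf

lemma zpow (hf : HasTaylorSeriesOver K f) (h0 : f 0 ≠ 0) (n : ℤ) :
    HasTaylorSeriesOver K (f ^ n) := by
  cases n with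
  | ofNat n => simpa using hf.pow n
  | negSucc n => simpa using (hf.pow (n + 1)).inv (by simpa using h0)

end HasTaylorSeriesOver

lemma exists_iteratedDeriv_eq_intCast {ι : Type*} {l : Filter ι} [l.NeBot]
    {P : ι → Polynomial ℤ} {f : ℂ → ℂ} {U : Set ℂ} (hU : IsOpen U) (h0 : (0 : ℂ) ∈ U)
    (h : TendstoLocallyUniformlyOn (fun i z ↦ Polynomial.aeval z (P i)) f l U) (k : ℕ) :
    ∃ m : ℤ, iteratedDeriv k f 0 = m := by
  induction k generalizing P f with
  | zero =>
    obtain ⟨m, hm⟩ : f 0 ∈ Set.range ((↑) : ℤ → ℂ) := by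
      refine Complex.isClosed_range_intCast.mem_of_tendsto (h.tendsto_at h0)
        (.of_forall fun i ↦ ⟨(P i).coeff 0, ?_⟩)
      rw [← Polynomial.coeff_zero_eq_aeval_zero', eq_intCast]
    exact ⟨m, by rw [iteratedDeriv_zero, hm]⟩
  | succ k ih =>
    rw [iteratedDeriv_succ']
    have hderiv := h.deriv
      (.of_forall fun i ↦ (Polynomial.differentiable_aeval _).differentiableOn) hU
    exact ih (P := fun i ↦ (P i).derivative) (hderiv.congr fun i z _ ↦ by simp)

lemma HasTaylorSeriesOver.of_iteratedDeriv_eq_intCast {K : Type*} [Field K] [Algebra K ℂ]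
    {f : ℂ → ℂ} (hf : AnalyticAt ℂ f 0) (h : ∀ n, ∃ m : ℤ, iteratedDeriv n f 0 = m) :
    HasTaylorSeriesOver K f := by
  choose m hm using h
  refine ⟨hf, .mk fun n ↦ (n.factorial : K)⁻¹ * m n, ?_⟩
  ext n
  simp [taylorSeries, hm]

/-! ### The expansion at infinity -/

section Expansion

/-- The Euler product `∏ (1 - q ^ n)` as a function of `q`. -/
noncomputable def eulerProduct (q : ℂ) : ℂ := ∏' n : ℕ, (1 - q ^ (n + 1))

lemma eulerProduct_ne_zero {q : ℂ} (hq : ‖q‖ < 1) : eulerProduct q ≠ 0 := by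
  simp only [eulerProduct, sub_eq_add_neg]
  refine tprod_one_add_ne_zero_of_summable (fun n h ↦ ?_) ?_
  · have hone : ‖q‖ ^ (n + 1) = 1 := by
      rw [← norm_pow, show q ^ (n + 1) = 1 by linear_combination -h, norm_one]
    exact (pow_lt_one₀ (norm_nonneg q) hq n.succ_ne_zero).ne hone
  · simpa using (summable_nat_add_iff 1).2 (summable_geometric_of_lt_one (norm_nonneg _) hq)

lemma mapsTo_pow_ball {m : ℕ} (hm : 0 < m) :
    Set.MapsTo (fun q : ℂ ↦ q ^ m) (Metric.ball 0 1) (Metric.ball 0 1) := by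
  intro q hq
  simp only [mem_ball_zero_iff, norm_pow] at hq ⊢
  exact pow_lt_one₀ (norm_nonneg _) hq hm.ne'

lemma differentiableOn_eulerProduct_pow {m : ℕ} (hm : 0 < m) :
    DifferentiableOn ℂ (fun q ↦ eulerProduct (q ^ m)) (Metric.ball 0 1) :=
  differentiableOn_tprod_one_sub_pow.comp (by fun_prop) (mapsTo_pow_ball hm)

lemma hasTaylorSeriesOver_eulerProduct_pow {K : Type*} [Field K] [Algebra K ℂ] {m : ℕ}
    (hm : 0 < m) : HasTaylorSeriesOver K fun q ↦ eulerProduct (q ^ m) := by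
  have h0 : (0 : ℂ) ∈ Metric.ball (0 : ℂ) 1 := Metric.mem_ball_self one_pos
  have hprod := hasProdLocallyUniformlyOn_iff_tendstoLocallyUniformlyOn.1
    multipliableLocallyUniformlyOn_one_sub_pow.hasProdLocallyUniformlyOn
  have hlim : TendstoLocallyUniformlyOn (fun (s : Finset ℕ) (z : ℂ) ↦ Polynomial.aeval z
      (∏ n ∈ s, (1 - (Polynomial.X ^ m) ^ (n + 1)) : Polynomial ℤ))
      (fun q ↦ eulerProduct (q ^ m)) atTop (Metric.ball 0 1) :=
    (hprod.comp (fun q : ℂ ↦ q ^ m) (mapsTo_pow_ball hm) (by fun_prop)).congr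
      fun s z _ ↦ by simp
  exact .of_iteratedDeriv_eq_intCast
    ((differentiableOn_eulerProduct_pow hm).analyticAt (Metric.isOpen_ball.mem_nhds h0))
    (exists_iteratedDeriv_eq_intCast Metric.isOpen_ball h0 hlim)

lemma qParam_natCast_mul (h : ℝ) (m : ℕ) (z : ℂ) :
    Function.Periodic.qParam h (m * z) = Function.Periodic.qParam h z ^ m := by
  rw [Function.Periodic.qParam, Function.Periodic.qParam, ← Complex.exp_nat_mul]
  ring_nf

lemma qParam_twentyFour_zpow_mul (z : ℂ) (M : ℤ) :
    Function.Periodic.qParam 24 z ^ (24 * M) = Function.Periodic.qParam 1 z ^ M := by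
  have h24 : Function.Periodic.qParam 24 (24 * z) = Function.Periodic.qParam 1 z := by
    simp [Function.Periodic.qParam, mul_left_comm _ (24 : ℂ)]
  rw [zpow_mul, ← h24]
  exact_mod_cast congrArg (· ^ M) (qParam_natCast_mul 24 24 z).symm

lemma eta_natCast_mul (m : ℕ) (z : ℂ) :
    eta (m * z) =
      Function.Periodic.qParam 24 z ^ m * eulerProduct (Function.Periodic.qParam 1 z ^ m) := by
  simp only [eta, eta_q, eulerProduct, qParam_natCast_mul]

variable {ι : Type*} {s : Finset ι} {δ : ι → ℕ} {r : ι → ℤ}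

lemma etaQuotient_eq_qParam_zpow_mul {M : ℤ} (hM : ∑ i ∈ s, r i * δ i = 24 * M) (τ : ℍ) :
    etaQuotient s δ r τ = Function.Periodic.qParam 1 τ ^ M *
      ∏ i ∈ s, eulerProduct (Function.Periodic.qParam 1 τ ^ δ i) ^ r i := by
  have hq : Function.Periodic.qParam 24 (τ : ℂ) ≠ 0 := Function.Periodic.qParam_ne_zero _
  simp only [etaQuotient, eta_natCast_mul, mul_zpow, Finset.prod_mul_distrib, ← zpow_natCast,
    ← zpow_mul, mul_comm _ (r _)]
  rw [prod_zpow_eq_zpow_sum hq, hM, qParam_twentyFour_zpow_mul]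

theorem hasRationalFourierCoefficients_etaQuotient (hδ : ∀ i ∈ s, 0 < δ i)
    (h24 : 24 ∣ ∑ i ∈ s, r i * δ i) : HasRationalFourierCoefficients (etaQuotient s δ r) := by
  obtain ⟨M, hM⟩ := h24
  set G : ℂ → ℂ := ∏ i ∈ s, (fun q ↦ eulerProduct (q ^ δ i)) ^ r i with hG
  have hne {i : ι} (hi : i ∈ s) {q : ℂ} (hq : q ∈ Metric.ball 0 1) : eulerProduct (q ^ δ i) ≠ 0 :=
    eulerProduct_ne_zero (by simpa using mapsTo_pow_ball (hδ i hi) hq)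
  have hdiff : DifferentiableOn ℂ G (Metric.ball 0 1) := .finsetProd fun i hi q hq ↦
    (differentiableOn_eulerProduct_pow (hδ i hi) q hq).zpow (.inl (hne hi hq))
  obtain ⟨-, p, hp⟩ : HasTaylorSeriesOver ℚ G := .prod fun i hi ↦
    (hasTaylorSeriesOver_eulerProduct_pow (hδ i hi)).zpow (hne hi (Metric.mem_ball_self one_pos)) _
  refine ⟨_, hasFourierExpansion_of_hasSum M (taylorSeries G) fun τ ↦ ?_, fun n ↦ ?_⟩
  · have hq0 : Function.Periodic.qParam 1 (τ : ℂ) ≠ 0 := Function.Periodic.qParam_ne_zero _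
    have hq : Function.Periodic.qParam 1 (τ : ℂ) ∈ Metric.ball 0 1 := by
      simpa using Function.Periodic.norm_qParam_lt_one one_pos τ.im_pos
    rw [Nat.cast_one, etaQuotient_eq_qParam_zpow_mul hM, mul_right_comm, ← zpow_add₀ hq0,
      add_neg_cancel, zpow_zero, one_mul]
    simpa [hG] using hasSum_taylorSeries hdiff hq
  · rw [HahnSeries.coeff_single_mul, PowerSeries.coeff_coe, hp]
    split_ifs with hneg
    · exact ⟨0, by simp⟩
    · exact ⟨p.coeff (n - M).natAbs, by simp⟩

end Expansion

/-! ### The eta quotient `g` -/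

section SquarefreeDivisors

variable {N : ℕ} {S : Finset ℕ}

lemma primeProd_dvd (hS : S ⊆ N.primeFactors) : primeProd S ∣ N :=
  (Finset.prod_dvd_prod_of_subset _ _ _ hS).trans (Nat.prod_primeFactors_dvd N)

lemma primeProd_pos (hS : S ⊆ N.primeFactors) : 0 < primeProd S :=
  Finset.prod_pos fun _ hp ↦ Nat.pos_of_mem_primeFactors (hS hp)

lemma div_primeProd_eq_mul_prod_sdiff (hS : S ⊆ N.primeFactors) :
    N / primeProd S = N / primeProd N.primeFactors * ∏ p ∈ N.primeFactors \ S, p := by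
  refine Nat.div_eq_of_eq_mul_left (primeProd_pos hS) ?_
  rw [mul_assoc, primeProd, primeProd, Finset.prod_sdiff hS,
    Nat.div_mul_cancel (Nat.prod_primeFactors_dvd N)]

lemma div_primeProd_eq_mul_div_primeProd_insert {p : ℕ} (hp : p ∉ S)
    (hS : insert p S ⊆ N.primeFactors) :
    N / primeProd S = p * (N / primeProd (insert p S)) := by
  have hins : primeProd (insert p S) = primeProd S * p :=
    (Finset.prod_insert hp).trans (mul_comm _ _)
  have hdvd : primeProd S * p ∣ N := hins ▸ primeProd_dvd hS
  rw [hins, ← Nat.div_div_eq_div_mul, Nat.mul_div_cancel' (Nat.dvd_div_of_mul_dvd hdvd)]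

lemma natCast_totProd (N : ℕ) : (totProd N : ℤ) = ∏ p ∈ N.primeFactors, ((p : ℤ) - 1) := by
  rw [totProd, Nat.cast_prod]
  exact Finset.prod_congr rfl fun p hp ↦ Nat.cast_pred (Nat.pos_of_mem_primeFactors hp)

lemma sum_neg_one_pow_card_mul_primeProd (N : ℕ) :
    ∑ S ∈ N.primeFactors.powerset, (-1) ^ S.card * (primeProd S : ℤ) =
      (-1) ^ N.primeFactors.card * totProd N := by
  have hsub := Finset.prod_sub (fun _ ↦ (1 : ℤ)) (fun p : ℕ ↦ (p : ℤ)) N.primeFactors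
  simp only [Finset.prod_const_one, mul_one] at hsub
  simp only [primeProd, Nat.cast_prod]
  rw [← hsub, natCast_totProd, ← Finset.prod_neg]
  exact Finset.prod_congr rfl fun _ _ ↦ (neg_sub _ _).symm

lemma sum_neg_one_pow_card_mul_div_primeProd (N : ℕ) :
    ∑ S ∈ N.primeFactors.powerset, (-1) ^ S.card * ((N / primeProd S : ℕ) : ℤ) =
      (N / primeProd N.primeFactors : ℕ) * totProd N := by
  have hsub := Finset.prod_sub (fun p : ℕ ↦ (p : ℤ)) (fun _ ↦ (1 : ℤ)) N.primeFactors
  rw [natCast_totProd, hsub, Finset.mul_sum]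
  refine Finset.sum_congr rfl fun S hS ↦ ?_
  rw [div_primeProd_eq_mul_prod_sdiff (Finset.mem_powerset.1 hS), Finset.prod_const_one, mul_one]
  push_cast
  ring

end SquarefreeDivisors

-- Pairing `S` with `insert p S` for a fixed `p` leaves the factor `f p ^ 2 ^ (#A - 1)`.
lemma isSquare_prod_powerset {α M : Type*} [DecidableEq α] [CommMonoid M] {A : Finset α}
    (hA : 2 ≤ A.card) {F : Finset α → M} {f : α → M}
    (hF : ∀ p S, p ∉ S → insert p S ⊆ A → F S = f p * F (insert p S)) :
    IsSquare (∏ S ∈ A.powerset, F S) := by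
  obtain ⟨p, hp⟩ : A.Nonempty := Finset.card_pos.1 (by omega)
  have hmem : p ∉ A.erase p := Finset.notMem_erase p A
  have hcard : A.card - 1 ≠ 0 := by omega
  have hpair : ∏ S ∈ (A.erase p).powerset, F S =
      f p ^ 2 ^ (A.card - 1) * ∏ S ∈ (A.erase p).powerset, F (insert p S) := by
    rw [← Finset.card_erase_of_mem hp, ← Finset.card_powerset, ← Finset.prod_const,
      ← Finset.prod_mul_distrib]
    refine Finset.prod_congr rfl fun S hS ↦ ?_
    rw [Finset.mem_powerset] at hS
    refine hF p S (fun h ↦ hmem (hS h)) ?_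
    rw [← Finset.insert_erase hp]
    exact Finset.insert_subset_insert p hS
  rw [← Finset.insert_erase hp, Finset.prod_powerset_insert hmem, hpair, mul_assoc]
  exact .mul ((Nat.even_pow.2 ⟨even_two, hcard⟩).isSquare_pow _) (.mul_self _)

lemma newmanConditions_div_primeProd {N k : ℕ} (hN : 2 ≤ N) (h24 : 24 ∣ k * totProd N)
    (hk : Odd k → 2 ≤ N.primeFactors.card) :
    NewmanConditions N N.primeFactors.powerset (fun S ↦ N / primeProd S)
      (fun S ↦ (-1) ^ S.card * k) where
  ne_zero := by omega
  dvd S hS := Nat.div_dvd_of_dvd (primeProd_dvd (Finset.mem_powerset.1 hS))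
  sum_eq_zero := by
    rw [← Finset.sum_mul, Finset.sum_powerset_neg_one_pow_card_of_nonempty
      (Nat.nonempty_primeFactors.2 hN), zero_mul]
  dvd_sum_mul := by
    have h24' : (24 : ℤ) ∣ k * totProd N := mod_cast h24
    simp only [mul_right_comm _ (k : ℤ), ← Finset.sum_mul,
      sum_neg_one_pow_card_mul_div_primeProd]
    rw [mul_assoc, mul_comm _ (k : ℤ)]
    exact h24'.mul_left _
  dvd_sum_mul_div := by
    have h24' : (24 : ℤ) ∣ k * totProd N := mod_cast h24
    have hdiv : ∀ S ∈ N.primeFactors.powerset, (-1) ^ S.card * (k : ℤ) *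
        (N / (N / primeProd S) : ℕ) = (-1) ^ S.card * primeProd S * k := fun S hS ↦ by
      rw [Nat.div_div_self (primeProd_dvd (Finset.mem_powerset.1 hS)) (by omega), mul_right_comm]
    rw [Finset.sum_congr rfl hdiv, ← Finset.sum_mul, sum_neg_one_pow_card_mul_primeProd,
      mul_assoc, mul_comm _ (k : ℤ)]
    exact h24'.mul_left _
  isSquare_prod := by
    simp only [Int.natAbs_mul, Int.natAbs_pow, Int.natAbs_neg, Int.natAbs_one, one_pow, one_mul,
      Int.natAbs_natCast, Finset.prod_pow]
    rcases k.even_or_odd with heven | hodd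
    · exact heven.isSquare_pow _
    · exact (isSquare_prod_powerset (hk hodd) (f := id)
        fun _ _ ↦ div_primeProd_eq_mul_div_primeProd_insert).pow k

/-- `24 μ_N / gcd(24, P_N)`, the absolute value of all the exponents of `g N`. -/
def absExponent (N : ℕ) : ℕ := 24 / Nat.gcd 24 (totProd N) * mu N

lemma exponent_eq (N : ℕ) (S : Finset ℕ) : exponent N S = (-1) ^ S.card * absExponent N := by
  obtain ⟨k, hk⟩ := Nat.gcd_dvd_left 24 (totProd N)
  have hpos : 0 < Nat.gcd 24 (totProd N) := Nat.gcd_pos_of_pos_left _ (by norm_num)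
  have hk' : (24 : ℤ) = Nat.gcd 24 (totProd N) * k := mod_cast hk
  rw [exponent, absExponent, Nat.div_eq_of_eq_mul_right hpos hk]
  refine Int.ediv_eq_of_eq_mul_right (mod_cast hpos.ne') ?_
  push_cast
  linear_combination (-1) ^ S.card * (mu N : ℤ) * hk'

lemma dvd_absExponent_mul_totProd (N : ℕ) : 24 ∣ absExponent N * totProd N := by
  rw [absExponent, mul_right_comm]
  refine Dvd.dvd.mul_right ?_ _
  nth_rw 1 [← Nat.div_mul_cancel (Nat.gcd_dvd_left 24 (totProd N))]
  exact mul_dvd_mul_left _ (Nat.gcd_dvd_right _ _)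

lemma two_le_card_primeFactors_of_odd_absExponent {N : ℕ} (hN : 2 ≤ N)
    (hodd : Odd (absExponent N)) : 2 ≤ N.primeFactors.card := by
  obtain ⟨hquot, hmu⟩ := Nat.odd_mul.1 hodd
  have h8 : 8 ∣ totProd N := by
    have hcop : Nat.Coprime 8 (24 / Nat.gcd 24 (totProd N)) :=
      (Nat.coprime_two_left.2 hquot).pow_left 3
    refine (hcop.dvd_of_dvd_mul_right ?_).trans (Nat.gcd_dvd_right 24 _)
    rw [Nat.mul_div_cancel' (Nat.gcd_dvd_left _ _)]
    norm_num
  by_contra! hlt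
  have hcard : N.primeFactors.card = 1 :=
    le_antisymm (by omega) (Nat.nonempty_primeFactors.2 hN).card_pos
  obtain ⟨p, hp⟩ := Finset.card_eq_one.1 hcard
  have hp1 : 1 ≤ p := Nat.pos_of_mem_primeFactors (hp ▸ Finset.mem_singleton_self p)
  have hp8 : p ≡ 1 [MOD 8] := by
    rw [totProd, hp, Finset.prod_singleton] at h8
    exact ((Nat.modEq_iff_dvd' hp1).2 h8).symm
  have hmu2 : mu N = 2 := if_pos ⟨hcard, by simpa [hp] using hp8⟩
  exact absurd (hmu2 ▸ hmu) (by decide)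

lemma newmanConditions_exponent {N : ℕ} (hN : 2 ≤ N) :
    NewmanConditions N N.primeFactors.powerset (fun S ↦ N / primeProd S) (exponent N) := by
  rw [funext (exponent_eq N)]
  exact newmanConditions_div_primeProd hN (dvd_absExponent_mul_totProd N)
    (two_le_card_primeFactors_of_odd_absExponent hN)

lemma g_eq_etaQuotient (N : ℕ) :
    g N = etaQuotient N.primeFactors.powerset (fun S ↦ N / primeProd S) (exponent N) :=
  rfl

end EtaQuotient

theorem proposition2p3 (N : ℕ) (hN : 2 ≤ N) :
    EtaQuotient.IsWeaklyHolomorphicModularFunction (CongruenceSubgroup.Gamma0 N)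
        (EtaQuotient.g N) ∧
      EtaQuotient.HasRationalFourierCoefficients (EtaQuotient.g N) := by
  have h := EtaQuotient.newmanConditions_exponent hN
  rw [EtaQuotient.g_eq_etaQuotient]
  exact ⟨h.isWeaklyHolomorphicModularFunction,
    EtaQuotient.hasRationalFourierCoefficients_etaQuotient h.pos h.dvd_sum_mul⟩
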